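/- Let the constants $C_1,C_2,C_4,C_5,C_7,C_9$, $L_3,L_6,L_8$, $R_1,R_2,R_4,R_5,R_7,R_{01},R_{02},R_{04},R_{08}$, $R_L$, $V_{PV}$, $V_B$ be positive, let $V_S(t)>0$ for $t\ge 0$, and consider the averaged DC-microgrid model with state $x\in\mathbb R^9$ and inputs $u_1,u_2,u_3$ $$ \begin{aligned} \dot x_1&=-\tfrac{1}{R_1C_1}x_1-\tfrac1{C_1}x_3+\tfrac1{R_1C_1}V_{PV}, & \dot x_2&=-\tfrac{1}{R_2C_2}x_2+\tfrac1{C_2}(1-u_1)x_3+\tfrac1{R_2C_2}x_9,\\ \dot x_3&=\tfrac1{L_3}\bigl[x_1-x_2-R_{01}x_3+(x_2+(R_{01}-R_{02})x_3)u_1\bigr], & \dot x_4&=-\tfrac{1}{R_4C_4}x_4-\tfrac1{C_4}x_6+\tfrac1{R_4C_4}V_{B},\\ \dot x_5&=-\tfrac{1}{R_5C_5}x_5+\tfrac1{C_5}(1-u_2)x_6+\tfrac1{R_5C_5}x_9, & \dot x_6&=\tfrac1{L_6}\bigl[x_4-x_5-R_{04}x_6+x_5u_2\bigr],\\ \dot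 x_7&=-\tfrac{1}{R_7C_7}x_7-\tfrac1{C_7}x_8+\tfrac1{R_7C_7}x_9, & \dot x_8&=\tfrac1{L_8}\bigl[V_Su_3-R_{08}x_8-x_7\bigr],\\ \dot x_9&=\tfrac1{C_9}\Bigl[\tfrac{x_2-x_9}{R_2}+\tfrac{x_5-x_9}{R_5}+\tfrac{x_7-x_9}{R_7}-\tfrac{x_9}{R_L}\Bigr]. \end{aligned} $$ Let $\gamma_1=\frac{R_{01}}{R_1}\frac1{1+R_{01}/R_1}$ and let references $x_1^*\in[\gamma_1V_{PV},V_{PV}]$, $x_9^*>0$, $x_4^*>0$ be given. Put $$ a_2=\tfrac{R_{01}-R_{02}}{R_1}(V_{PV}-x_1^*),\quad \Delta_2=\tfrac1{R_1C_2}(V_{PV}-x_1^*)\bigl[x_1^*-\tfrac{R_{02}}{R_1}(V_{PV}-x_1^*)\bigr],\quad \Delta_5=\tfrac1{R_4C_5}(V_B-x_4^*)\bigl[x_4^*-\tfrac{R_{04}}{R_4}(V_B-x_4^*)\bigr], $$ $$ x_2^*=\tfrac{x_9^*-a_2}2+\tfrac12\sqrt{(x_9^*-a_2)^2+4(R_2C_2\Delta_2+a_2x_9^*)},\qquad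 x_5^*=\tfrac{x_9^*}2+\tfrac12\sqrt{(x_9^*)^2+4R_5C_5\Delta_5}, $$ where both radicands are assumed nonnegative (so that these steady-state values exist), assume the current balance $\frac1{R_L}x_9^*=\frac1{R_2}(x_2^*-x_9^*)+\frac1{R_5}(x_5^*-x_9^*)$, and put $$x^e=\Bigl(x_1^*,\,x_2^*,\,\tfrac1{R_1}(V_{PV}-x_1^*),\,x_4^*,\,x_5^*,\,\tfrac1{R_4}(V_B-x_4^*),\,x_9^*,\,0,\,x_9^*\Bigr).$$ Call a state $x$ admissible if the control denominators do not vanish: $x_2+(R_{01}-R_{02})x_3\ne0$, $x_5\ne0$, $x_9\ne0$; assume that $x^e$ is admissible. For positive gains $K_i,\overline K_i,K_i^\alpha$ ($i=1,3,4,6$), $K_7,K_8$, consider the PI/backstepping laws with integral terms $\alpha_1,\alpha_3,\alpha_4,\alpha_6$: writing $$ \begin{aligned} z_3&=\tfrac1{R_1}(V_{PV}-x_1)+C_1K_1(x_1-x_1^*)+C_1\overline K_1\alpha_1,\\ z_6&=\tfrac1{R_4}(V_B-x_4)+C_4K_4(x_4-x_4^*)+C_4\overline K_4\alpha_4,\\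 \dot\alpha_1&=K_1^\alpha(x_1-x_1^*),\quad \dot\alpha_3=K_3^\alpha(x_3-z_3),\quad \dot\alpha_4=K_4^\alpha(x_4-x_4^*),\quad \dot\alpha_6=K_6^\alpha(x_6-z_6),\\ v_1&=K_3(x_3-z_3)+\overline K_3\alpha_3-C_1\overline K_1K_1^\alpha(x_1-x_1^*)+\bigl(C_1K_1-\tfrac1{R_1}\bigr)\bigl(K_1(x_1-x_1^*)+\overline K_1\alpha_1\bigr),\\ v_2&=-K_6(x_6-z_6)-\overline K_6\alpha_6+C_4\overline K_4K_4^\alpha(x_4-x_4^*)-\bigl(C_4K_4-\tfrac1{R_4}\bigr)\bigl(K_4(x_4-x_4^*)+\overline K_4\alpha_4\bigr), \end{aligned} $$ they are $$ u_1=\frac{-x_1+x_2+R_{01}x_3-L_3v_1}{x_2+(R_{01}-R_{02})x_3},\qquad u_2=\frac{-x_4+x_5+R_{04}x_6+L_6v_2}{x_5}, $$ $$ u_3=\tfrac1{V_S}\bigl[x_7+R_{08}x_8+L_8\dot z_8-L_8K_8(x_8-z_8)\bigr],\qquad z_8=C_7K_7(x_7-z_7)-\tfrac1{R_7}(x_7-x_9)-C_7\dot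 z_7, $$ $$ \begin{aligned} z_7={}&-\tfrac{R_7}{x_9}(x_2-x_2^*)\bigl(\tfrac1{R_2}(x_9-x_2^*)+x_3(1-u_1)\bigr)-\tfrac{R_7}{x_9}(x_5-x_5^*)\bigl(\tfrac1{R_5}(x_9-x_5^*)+x_6(1-u_2)\bigr)\\ &+R_7\bigl[\tfrac{x_9}{R_L}-\tfrac1{R_2}(x_2-x_9)-\tfrac1{R_5}(x_5-x_9)\bigr]+\tfrac1{x_9}\bigl(-(x_9^*)^2+2x_9x_9^*\bigr), \end{aligned} $$ where $\dot z_7,\dot z_8$ denote the derivatives along the closed loop; these are functions of $x$ and the integral terms only. Then the gains can be chosen, independently of $V_S$, such that $x^e$ (with zero integral terms) is an equilibrium point of the closed loop, and every evolution of the closed loop on $[0,\infty)$, from any initial values of the state and of the integral terms, along which $x(t)$ is admissible for every $t\ge0$, satisfies $x(t)\to x^e$ as $t\to\infty$. -/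

import Mathlib

open Filter Topology Set

noncomputable section

/-- The (positive, constant) parameters of the averaged DC microgrid: capacitances, inductances,
resistances, the load resistance `RL`, the photovoltaic panel voltage `VPV` and the battery
voltage `VB`. -/
structure Microgrid where
  (C1 C2 C4 C5 C7 C9 : ℝ)
  (L3 L6 L8 : ℝ)
  (R1 R2 R4 R5 R7 R01 R02 R04 R08 : ℝ)
  (RL VPV VB : ℝ)
  C1_pos : 0 < C1
  C2_pos : 0 < C2
  C4_pos : 0 < C4
  C5_pos : 0 < C5
  C7_pos : 0 < C7
  C9_pos : 0 < C9
  L3_pos : 0 < L3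
  L6_pos : 0 < L6
  L8_pos : 0 < L8
  R1_pos : 0 < R1
  R2_pos : 0 < R2
  R4_pos : 0 < R4
  R5_pos : 0 < R5
  R7_pos : 0 < R7
  R01_pos : 0 < R01
  R02_pos : 0 < R02
  R04_pos : 0 < R04
  R08_pos : 0 < R08
  RL_pos : 0 < RL
  VPV_pos : 0 < VPV
  VB_pos : 0 < VB

/-- The state `(x₁, …, x₉)`; the entry with index `i : Fin 9` is the component `x_{i+1}`. -/
abbrev GridState := Fin 9 → ℝ

/-- The state of the grid together with the integral terms `(α₁, α₃, α₄, α₆)` of the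
controller. -/
abbrev AugState := GridState × (Fin 4 → ℝ)

/-- The reference values `x₁*`, `x₄*`, `x₉*`. -/
structure References where
  (x1 x4 x9 : ℝ)

namespace Microgrid

/-- Right-hand side of the averaged model; `vS` is the current supercapacitor voltage. -/
def field (M : Microgrid) (vS u1 u2 u3 : ℝ) (x : GridState) : GridState :=
  ![-(1 / (M.R1 * M.C1)) * x 0 - 1 / M.C1 * x 2 + 1 / (M.R1 * M.C1) * M.VPV,
    -(1 / (M.R2 * M.C2)) * x 1 + 1 / M.C2 * x 2 - 1 / M.C2 * u1 * x 2
      + 1 / (M.R2 * M.C2) * x 8,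
    1 / M.L3 * (x 0 - x 1 - M.R01 * x 2) + 1 / M.L3 * (x 1 + (M.R01 - M.R02) * x 2) * u1,
    -(1 / (M.R4 * M.C4)) * x 3 - 1 / M.C4 * x 5 + 1 / (M.R4 * M.C4) * M.VB,
    -(1 / (M.R5 * M.C5)) * x 4 + 1 / M.C5 * x 5 - 1 / M.C5 * u2 * x 5
      + 1 / (M.R5 * M.C5) * x 8,
    1 / M.L6 * x 3 - 1 / M.L6 * x 4 - M.R04 / M.L6 * x 5 + 1 / M.L6 * x 4 * u2,
    -(1 / (M.R7 * M.C7)) * x 6 - 1 / M.C7 * x 7 + 1 / (M.R7 * M.C7) * x 8,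
    1 / M.L8 * vS * u3 - M.R08 / M.L8 * x 7 - 1 / M.L8 * x 6,
    1 / M.C9 * ((x 1 - x 8) / M.R2 + (x 4 - x 8) / M.R5 + (x 6 - x 8) / M.R7
      - x 8 * (1 / M.RL))]

/-- The control denominators do not vanish. -/
def Admissible (M : Microgrid) (x : GridState) : Prop :=
  x 1 + (M.R01 - M.R02) * x 2 ≠ 0 ∧ x 4 ≠ 0 ∧ x 8 ≠ 0

def gamma1 (M : Microgrid) : ℝ := M.R01 / M.R1 * (1 / (1 + M.R01 / M.R1))

def a2 (M : Microgrid) (r : References) : ℝ := (M.R01 - M.R02) / M.R1 * (M.VPV - r.x1)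

def delta2 (M : Microgrid) (r : References) : ℝ :=
  1 / (M.R1 * M.C2) * (M.VPV - r.x1) * (r.x1 - M.R02 / M.R1 * (M.VPV - r.x1))

/-- The radicand in the formula for `x₂*`. -/
def radicand2 (M : Microgrid) (r : References) : ℝ :=
  (r.x9 - M.a2 r) ^ 2 + 4 * (M.R2 * M.C2 * M.delta2 r + M.a2 r * r.x9)

/-- The steady-state value `x₂*`. -/
def x2Star (M : Microgrid) (r : References) : ℝ :=
  (r.x9 - M.a2 r) / 2 + 1 / 2 * √(M.radicand2 r)

def delta5 (M : Microgrid) (r : References) : ℝ :=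
  1 / (M.R4 * M.C5) * (M.VB - r.x4) * (r.x4 - M.R04 / M.R4 * (M.VB - r.x4))

/-- The radicand in the formula for `x₅*`. -/
def radicand5 (M : Microgrid) (r : References) : ℝ :=
  r.x9 ^ 2 + 4 * M.R5 * M.C5 * M.delta5 r

/-- The steady-state value `x₅*`. -/
def x5Star (M : Microgrid) (r : References) : ℝ :=
  r.x9 / 2 + 1 / 2 * √(M.radicand5 r)

/-- The balance of the currents at the reference values. -/
def CurrentBalance (M : Microgrid) (r : References) : Prop :=
  1 / M.RL * r.x9 = 1 / M.R2 * (M.x2Star r - r.x9) + 1 / M.R5 * (M.x5Star r - r.x9)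

/-- The equilibrium `xᵉ`. -/
def xe (M : Microgrid) (r : References) : GridState :=
  ![r.x1, M.x2Star r, 1 / M.R1 * (M.VPV - r.x1), r.x4, M.x5Star r, 1 / M.R4 * (M.VB - r.x4),
    r.x9, 0, r.x9]

end Microgrid

/-- A dynamic feedback controller with four integral terms: `u1`, `u2` depend on the state of the
grid and the integral terms, `u3` depends also on the measured supercapacitor voltage, and
`integ` is the right-hand side of the differential equation of the integral terms. -/
structure Controller where
  u1 : AugState → ℝ
  u2 : AugState → ℝ
  u3 : ℝ → AugState → ℝ
  integ : AugState → (Fin 4 → ℝ)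

/-- The closed-loop vector field, for the supercapacitor voltage `vS`. -/
def Controller.closedLoop (c : Controller) (M : Microgrid) (vS : ℝ) (s : AugState) : AugState :=
  (M.field vS (c.u1 s) (c.u2 s) (c.u3 vS s) s.1, c.integ s)

/-- `s` is an evolution of the closed loop on `[0, ∞)` for the supercapacitor voltage `VS`. -/
def Controller.IsEvolution (c : Controller) (M : Microgrid) (VS : ℝ → ℝ) (s : ℝ → AugState) :
    Prop :=
  ∀ t, 0 ≤ t → HasDerivWithinAt s (c.closedLoop M (VS t) (s t)) (Ici 0) t

/-- The gains of the control laws: `K`, `Kbar` and `Kal` stand for `K`, `K̄` and `K^α`. -/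
structure Gains where
  (K1 Kbar1 Kal1 K3 Kbar3 Kal3 : ℝ)
  (K4 Kbar4 Kal4 K6 Kbar6 Kal6 : ℝ)
  (K7 K8 : ℝ)

/-- All gains are positive. -/
def Gains.Positive (K : Gains) : Prop :=
  (0 < K.K1 ∧ 0 < K.Kbar1 ∧ 0 < K.Kal1 ∧ 0 < K.K3 ∧ 0 < K.Kbar3 ∧ 0 < K.Kal3) ∧
  (0 < K.K4 ∧ 0 < K.Kbar4 ∧ 0 < K.Kal4 ∧ 0 < K.K6 ∧ 0 < K.Kbar6 ∧ 0 < K.Kal6) ∧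
  0 < K.K7 ∧ 0 < K.K8

namespace Microgrid

variable (M : Microgrid) (r : References) (K : Gains)

/-- The backstepping reference for the PV inductor current `x₃`. -/
def z3 (s : AugState) : ℝ :=
  1 / M.R1 * (M.VPV - s.1 0) + M.C1 * K.K1 * (s.1 0 - r.x1) + M.C1 * K.Kbar1 * s.2 0

def v1 (s : AugState) : ℝ :=
  K.K3 * (s.1 2 - M.z3 r K s) + K.Kbar3 * s.2 1 - M.C1 * K.Kbar1 * K.Kal1 * (s.1 0 - r.x1)
    + (M.C1 * K.K1 - 1 / M.R1) * (K.K1 * (s.1 0 - r.x1) + K.Kbar1 * s.2 0)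

/-- The control law of the PV converter. -/
def pvLaw (s : AugState) : ℝ :=
  1 / (s.1 1 + (M.R01 - M.R02) * s.1 2)
    * (-s.1 0 + s.1 1 + M.R01 * s.1 2 - M.L3 * M.v1 r K s)

/-- The backstepping reference for the battery inductor current `x₆`. -/
def z6 (s : AugState) : ℝ :=
  1 / M.R4 * (M.VB - s.1 3) + M.C4 * K.K4 * (s.1 3 - r.x4) + M.C4 * K.Kbar4 * s.2 2

def v2 (s : AugState) : ℝ :=
  -K.K6 * (s.1 5 - M.z6 r K s) - K.Kbar6 * s.2 3 + M.C4 * K.Kbar4 * K.Kal4 * (s.1 3 - r.x4)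
    - (M.C4 * K.K4 - 1 / M.R4) * (K.K4 * (s.1 3 - r.x4) + K.Kbar4 * s.2 2)

/-- The control law of the battery converter. -/
def batLaw (s : AugState) : ℝ :=
  1 / s.1 4 * (-s.1 3 + s.1 4 + M.R04 * s.1 5 + M.L6 * M.v2 r K s)

/-- The right-hand side of the equations of the integral terms `(α₁, α₃, α₄, α₆)`. -/
def integField (s : AugState) : Fin 4 → ℝ :=
  ![K.Kal1 * (s.1 0 - r.x1), K.Kal3 * (s.1 2 - M.z3 r K s),
    K.Kal4 * (s.1 3 - r.x4), K.Kal6 * (s.1 5 - M.z6 r K s)]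

/-- The desired value for `x₇`. -/
def z7 (s : AugState) : ℝ :=
  -M.R7 * (1 / s.1 8) * ((s.1 1 - M.x2Star r) *
      (1 / M.R2 * (s.1 8 - M.x2Star r) + s.1 2 * (1 - M.pvLaw r K s)))
  - M.R7 * (1 / s.1 8) * ((s.1 4 - M.x5Star r) *
      (1 / M.R5 * (s.1 8 - M.x5Star r) + s.1 5 * (1 - M.batLaw r K s)))
  + M.R7 * (s.1 8 / M.RL - 1 / M.R2 * (s.1 1 - s.1 8) - 1 / M.R5 * (s.1 4 - s.1 8))
  + 1 / s.1 8 * (-r.x9 ^ 2 + 2 * s.1 8 * r.x9)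

/-- The time derivative of a function `h` of the state along the closed loop, for functions `h`
that do not depend on `x₈` (such as the ones it is used for below): the equation of `x₈` is the
only one that contains `u₃` and the supercapacitor voltage, so their values are immaterial here
and are set to `0`. -/
def lieDeriv (h : AugState → ℝ) (s : AugState) : ℝ :=
  fderiv ℝ h s (M.field 0 (M.pvLaw r K s) (M.batLaw r K s) 0 s.1, M.integField r K s)

/-- The desired value for `x₈`. -/
def z8 (s : AugState) : ℝ :=
  M.C7 * K.K7 * (s.1 6 - M.z7 r K s) - 1 / M.R7 * (s.1 6 - s.1 8)
    - M.C7 * M.lieDeriv r K (M.z7 r K) s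

/-- The control law of the supercapacitor converter. -/
def scLaw (vS : ℝ) (s : AugState) : ℝ :=
  1 / vS * (s.1 6 + M.R08 * s.1 7 + M.L8 * M.lieDeriv r K (M.z8 r K) s
    - M.L8 * K.K8 * (s.1 7 - M.z8 r K s))

end Microgrid

/-- The PI / backstepping controller with gains `K`. -/
def piBackstepping (M : Microgrid) (r : References) (K : Gains) : Controller where
  u1 := M.pvLaw r K
  u2 := M.batLaw r K
  u3 := M.scLaw r K
  integ := M.integField r K

/-- `c` is a PI / backstepping controller for some choice of positive gains. -/
def IsPIBackstepping (M : Microgrid) (r : References) (c : Controller) : Prop :=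
  ∃ K : Gains, K.Positive ∧ c = piBackstepping M r K

end

noncomputable section

/-! The two converter laws invert the equations of x₃ and x₆, so the errors x₁ - x₁*, x₃ - z₃
(likewise for the battery) and their integrals obey linear cascades, made stable by `stableGains`.
The supercapacitor law does the same for e₇ = x₇ - z₇ and e₈ = x₈ - z₈; it is free of algebraic
loops because z₇ ignores x₇ and x₈, whence z₈ ignores x₈.

The voltages x₂, x₅, x₉ need a Lyapunov argument. The choice of z₇ makes the energy with terms (x₂ -
x₂*)², (x₅ - x₅*)², x₉² decrease at the rate `busDissipation`, up to x₉e₇/R₇ (`bus_power_balance`).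
Terms in e₇, e₈ added to the energy absorb this perturbation without an a priori bound on x₉.

Admissibility at each time does not keep the control denominators away from zero, so the derivative
of the dissipation may be unbounded and the usual Barbalat lemma does not apply.
`tendsto_zero_of_dissipation` asks for a bound only at late times with small dissipation. There the
state, up to x₈, is near the admissible point xᵉ, where everything is continuous
(`tendsto_reset_xe`). Convergence of x₇ and then x₈ follows from continuity of z₇ and z₈ at xᵉ. -/

/-! ### Scalar linear equations and a local Barbalat lemma -/

theorem antitoneOn_of_hasDerivWithinAt_Ici_nonpos {f f' : ℝ → ℝ} {D : Set ℝ} (hD : Convex ℝ D)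
    (hD0 : D ⊆ Ici 0) (hf : ∀ t, 0 ≤ t → HasDerivWithinAt f (f' t) (Ici 0) t)
    (hf' : ∀ t ∈ D, f' t ≤ 0) : AntitoneOn f D := by
  have hint : ∀ t ∈ interior D, HasDerivAt f (f' t) t := fun t ht =>
    (hf t (hD0 (interior_subset ht))).hasDerivAt
      (mem_of_superset (mem_interior_iff_mem_nhds.1 ht) hD0)
  refine antitoneOn_of_deriv_nonpos hD
    (fun t ht => ((hf t (hD0 ht)).continuousWithinAt).mono hD0)
    (fun t ht => (hint t ht).differentiableAt.differentiableWithinAt) fun t ht => ?_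
  rw [(hint t ht).deriv]
  exact hf' t (interior_subset ht)

/-- Integrating factor: once d ≤ aε/2, the function exp(at)(y - ε/2) is nonincreasing, so y exceeds
ε/2 by at most a decaying exponential. The lower bound comes from applying this to -y. -/
theorem eventually_lt_of_linear_ode {y d : ℝ → ℝ} {a : ℝ} (ha : 0 < a)
    (hy : ∀ t, 0 ≤ t → HasDerivWithinAt y (-a * y t + d t) (Ici 0) t)
    (hd : Tendsto d atTop (𝓝 0)) {ε : ℝ} (hε : 0 < ε) : ∀ᶠ t in atTop, y t < ε := by
  obtain ⟨T, hT0, hT⟩ : ∃ T, 0 ≤ T ∧ ∀ t, T ≤ t → d t ≤ a * (ε / 2) := by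
    obtain ⟨T, hT⟩ := eventually_atTop.1 (hd.eventually_le_const (show 0 < a * (ε / 2) by positivity))
    exact ⟨max T 0, le_max_right _ _, fun t ht => hT t (le_trans (le_max_left _ _) ht)⟩
  have hanti : AntitoneOn (fun t => Real.exp (a * t) * (y t - ε / 2)) (Ici T) := by
    refine antitoneOn_of_hasDerivWithinAt_Ici_nonpos
      (f' := fun t => Real.exp (a * t) * (d t - a * (ε / 2))) (convex_Ici T)
      (Ici_subset_Ici.2 hT0) (fun t ht => ?_) fun t ht => ?_
    · have h1 : HasDerivWithinAt (fun t => Real.exp (a * t)) (Real.exp (a * t) * (a * 1)) (Ici 0) t :=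
        (((hasDerivAt_id t).const_mul a).exp).hasDerivWithinAt
      exact (h1.mul ((hy t ht).sub_const (ε / 2))).congr_deriv (by ring)
    · exact mul_nonpos_of_nonneg_of_nonpos (Real.exp_pos _).le (by linarith [hT t ht])
  have hlim : Tendsto (fun t => Real.exp (-(a * t)) * (Real.exp (a * T) * (y T - ε / 2)))
      atTop (𝓝 0) := by
    have h := (Real.tendsto_exp_neg_atTop_nhds_zero.comp
      (tendsto_id.const_mul_atTop ha)).mul_const (Real.exp (a * T) * (y T - ε / 2))
    rw [zero_mul] at h
    exact h
  filter_upwards [hlim.eventually_lt_const (half_pos hε), eventually_ge_atTop T] with t h1 h2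
  have h3 := hanti self_mem_Ici (mem_Ici.2 h2) h2
  have h4 := mul_le_mul_of_nonneg_left h3 (Real.exp_pos (-(a * t))).le
  simp only at h4
  rw [← mul_assoc, ← Real.exp_add, neg_add_cancel, Real.exp_zero, one_mul] at h4
  linarith

/-- A stable scalar linear equation driven by a vanishing input. -/
theorem tendsto_zero_of_linear_ode {y d : ℝ → ℝ} {a : ℝ} (ha : 0 < a)
    (hy : ∀ t, 0 ≤ t → HasDerivWithinAt y (-a * y t + d t) (Ici 0) t)
    (hd : Tendsto d atTop (𝓝 0)) : Tendsto y atTop (𝓝 0) := by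
  refine tendsto_order.2 ⟨fun ε hε => ?_, fun ε hε => eventually_lt_of_linear_ode ha hy hd hε⟩
  have h := eventually_lt_of_linear_ode (y := fun t => -y t) (d := fun t => -d t) ha
    (fun t ht => ((hy t ht).fun_neg).congr_deriv (by ring)) (by simpa using hd.neg) (neg_pos.2 hε)
  filter_upwards [h] with t ht
  linarith

/-- A variant of Barbalat's lemma: the bound on the derivative of `q` is needed only where `q` is
small. -/
theorem tendsto_zero_of_dissipation {q q' U U' : ℝ → ℝ} {c m : ℝ} (hc : 0 < c)
    (hq : ∀ t, 0 ≤ t → HasDerivWithinAt q (q' t) (Ici 0) t)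
    (hU : ∀ t, 0 ≤ t → HasDerivWithinAt U (U' t) (Ici 0) t)
    (hdiss : ∀ t, 0 ≤ t → U' t ≤ -c * q t) (hm : ∀ t, 0 ≤ t → m ≤ U t)
    (hq0 : ∀ t, 0 ≤ q t)
    (hloc : ∀ᶠ t in atTop ⊓ comap q (𝓝 0), q' t ≤ 1) :
    Tendsto q atTop (𝓝 0) := by
  have hanti : AntitoneOn U (Ici 0) :=
    antitoneOn_of_hasDerivWithinAt_Ici_nonpos (convex_Ici 0) le_rfl hU fun t ht =>
      (hdiss t ht).trans (by nlinarith [hq0 t])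
  obtain ⟨T, ε₀, hT0, hε₀, hbd⟩ :
      ∃ T ε₀ : ℝ, 0 ≤ T ∧ 0 < ε₀ ∧ ∀ t, T ≤ t → q t < ε₀ → q' t ≤ 1 := by
    obtain ⟨S, hS, S', hS', h⟩ := eventually_inf.1 hloc
    obtain ⟨T, hT⟩ := mem_atTop_sets.1 hS
    obtain ⟨S'', hS'', hsub⟩ := mem_comap.1 hS'
    obtain ⟨ε₀, hε₀, hball⟩ := Metric.mem_nhds_iff.1 hS''
    refine ⟨max T 0, ε₀, le_max_right _ _, hε₀, fun t ht hqt =>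
      h t ⟨hT t (le_trans (le_max_left _ _) ht), hsub (hball ?_)⟩⟩
    rw [Metric.mem_ball, dist_zero_right, Real.norm_of_nonneg (hq0 t)]
    exact hqt
  obtain ⟨L, hL, hLlow⟩ : ∃ L, (∀ δ > 0, ∃ t, 0 ≤ t ∧ U t < L + δ) ∧ ∀ t, 0 ≤ t → L ≤ U t := by
    have hbdd : BddBelow (U '' Ici 0) := ⟨m, by rintro _ ⟨t, ht, rfl⟩; exact hm t ht⟩
    refine ⟨sInf (U '' Ici 0), fun δ hδ => ?_, fun t ht => csInf_le hbdd ⟨t, ht, rfl⟩⟩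
    obtain ⟨_, ⟨t, ht, rfl⟩, h⟩ := exists_lt_of_csInf_lt (nonempty_Ici.image U)
      (lt_add_of_pos_right (sInf (U '' Ici 0)) hδ)
    exact ⟨t, ht, h⟩
  refine tendsto_order.2 ⟨fun ε hε => Eventually.of_forall fun t => hε.trans_le (hq0 t),
    fun ε' hε' => ?_⟩
  -- Below this level the bound on `q'` is available.
  set ε := min ε' ε₀ with hεdef
  have hε : 0 < ε := lt_min hε' hε₀
  -- This is the drop of `U` forced by q ≥ ε/2 on a window of length ε/8; after `T₁` no such drop is
  -- left.
  obtain ⟨T₁, hT₁0, hT₁⟩ := hL (c * (ε / 2) * (ε / 8)) (by positivity)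
  filter_upwards [eventually_ge_atTop (max T T₁ + ε)] with t ht
  refine lt_of_lt_of_le ?_ (min_le_left ε' ε₀)
  by_contra! hqt
  have hTt : T + ε ≤ t := by linarith [le_max_left T T₁]
  have hT₁t : T₁ + ε ≤ t := by linarith [le_max_right T T₁]
  have hlow : ∀ s ∈ Icc (t - ε / 8) t, ε / 2 ≤ q s := by
    intro s hs
    by_contra! hqs
    have hs0 : 0 ≤ s := by linarith [hs.1]
    -- A barrier of slope 2 starting at ε/2 stays at or below 3ε/4 < ε₀ on the window, where `q` has
    -- slope at most 1. Hence `q` cannot cross it and reach ε by time `t`.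
    have key := image_le_of_deriv_right_lt_deriv_boundary' (f := q) (f' := q') (a := s) (b := t)
      (B := fun τ => ε / 2 + 2 * (τ - s)) (B' := fun _ => 2)
      (fun τ hτ => ((hq τ (hs0.trans hτ.1)).continuousWithinAt).mono
        fun u hu => hs0.trans hu.1)
      (fun τ hτ => (hq τ (hs0.trans hτ.1)).mono (Ici_subset_Ici.2 (hs0.trans hτ.1)))
      (by simp only [sub_self, mul_zero, add_zero]; exact hqs.le) (by fun_prop)
      (fun τ _ => ((((hasDerivAt_id τ).sub_const s).const_mul 2).const_add
        (ε / 2)).hasDerivWithinAt.congr_deriv (by ring))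
      (fun τ hτ h => by
        have h1 : q τ < ε₀ := by
          rw [h]
          have := min_le_right ε' ε₀
          have h2 := hτ.2
          have h3 := hs.1
          linarith
        linarith [hbd τ (by linarith [hs.1, hτ.1]) h1])
      (right_mem_Icc.2 hs.2)
    linarith [hs.1]
  have hdec : AntitoneOn (fun s => U s + c * (ε / 2) * s) (Icc (t - ε / 8) t) := by
    refine antitoneOn_of_hasDerivWithinAt_Ici_nonpos (f' := fun s => U' s + c * (ε / 2))
      (convex_Icc _ _) (fun s hs => ?_) (fun s hs => ?_) fun s hs => ?_
    · exact mem_Ici.2 (by linarith [hs.1])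
    · exact ((hU s hs).add ((hasDerivAt_id s).const_mul
        (c * (ε / 2))).hasDerivWithinAt).congr_deriv (by ring)
    · have h1 := hdiss s (by linarith [hs.1])
      nlinarith [hlow s hs]
  have h1 := hdec (left_mem_Icc.2 (by linarith)) (right_mem_Icc.2 (by linarith))
    (by linarith : t - ε / 8 ≤ t)
  have h2 := hanti (mem_Ici.2 hT₁0) (mem_Ici.2 (by linarith : (0:ℝ) ≤ t - ε / 8))
    (by linarith)
  have h3 := hLlow t (by linarith)
  dsimp only at h1
  linarith

/-! ### Independence of x₈ -/

/-- No differentiability is needed, since `fderiv` is zero where it fails; the invariance of z₈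
below thus holds at all states, admissible or not. -/
theorem fderiv_apply_eq_zero_of_invariant {E : Type*} [NormedAddCommGroup E] [NormedSpace ℝ E]
    {h : E → ℝ} {v : E} (hv : ∀ s (τ : ℝ), h (s + τ • v) = h s) (s : E) : fderiv ℝ h s v = 0 := by
  by_cases hd : DifferentiableAt ℝ h s
  · rw [← hd.lineDeriv_eq_fderiv, lineDeriv]
    simp [hv]
  · simp [fderiv_zero_of_not_differentiableAt hd]

theorem fderiv_eq_of_invariant {E : Type*} [NormedAddCommGroup E] [NormedSpace ℝ E]
    {h : E → ℝ} {v : E} (hv : ∀ s (τ : ℝ), h (s + τ • v) = h s) (s : E) (τ : ℝ) :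
    fderiv ℝ h (s + τ • v) = fderiv ℝ h s := by
  rw [← fderiv_comp_add_right]
  simp only [hv]

namespace Microgrid

variable (M : Microgrid) (r : References) (K : Gains)

/-- The unit vector of the component `i` of the state of the grid. -/
def unit (i : Fin 9) : AugState := (Pi.single i 1, 0)

theorem z7_add_unit6 (s : AugState) (τ : ℝ) : M.z7 r K (s + τ • unit 6) = M.z7 r K s := by
  simp [z7, pvLaw, batLaw, v1, v2, z3, z6, unit]

theorem pvLaw_add_unit7 (s : AugState) (τ : ℝ) :
    M.pvLaw r K (s + τ • unit 7) = M.pvLaw r K s := by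
  simp [pvLaw, v1, z3, unit]

theorem batLaw_add_unit7 (s : AugState) (τ : ℝ) :
    M.batLaw r K (s + τ • unit 7) = M.batLaw r K s := by
  simp [batLaw, v2, z6, unit]

theorem z7_add_unit7 (s : AugState) (τ : ℝ) : M.z7 r K (s + τ • unit 7) = M.z7 r K s := by
  simp only [z7, pvLaw_add_unit7, batLaw_add_unit7]
  simp [unit]

/-- The closed-loop vector field without the equation of `x₈`. -/
def drift (s : AugState) : AugState :=
  (M.field 0 (M.pvLaw r K s) (M.batLaw r K s) 0 s.1, M.integField r K s)

/-- x₈ enters only the equations of x₇ and of x₈ itself, directions that z₇ does not see. -/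
theorem drift_add_unit7 (s : AugState) (τ : ℝ) :
    M.drift r K (s + τ • unit 7) =
      M.drift r K s + (-(τ / M.C7)) • unit 6 + (-(M.R08 / M.L8 * τ)) • unit 7 := by
  simp only [drift, pvLaw_add_unit7, batLaw_add_unit7]
  generalize M.pvLaw r K s = u1
  generalize M.batLaw r K s = u2
  ext i
  · simp only [Prod.fst_add, Pi.add_apply, Prod.smul_fst, Pi.smul_apply, smul_eq_mul, unit]
    fin_cases i <;> simp [field] <;> ring
  · fin_cases i <;> simp [integField, z3, z6, unit]

theorem lieDeriv_z7_add_unit7 (s : AugState) (τ : ℝ) :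
    M.lieDeriv r K (M.z7 r K) (s + τ • unit 7) = M.lieDeriv r K (M.z7 r K) s := by
  change fderiv ℝ _ _ (M.drift r K (s + τ • unit 7)) = fderiv ℝ _ _ (M.drift r K s)
  rw [fderiv_eq_of_invariant (M.z7_add_unit7 r K), drift_add_unit7, map_add, map_add, map_smul,
    map_smul, fderiv_apply_eq_zero_of_invariant (M.z7_add_unit6 r K),
    fderiv_apply_eq_zero_of_invariant (M.z7_add_unit7 r K)]
  simp

theorem z8_add_unit7 (s : AugState) (τ : ℝ) : M.z8 r K (s + τ • unit 7) = M.z8 r K s := by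
  simp only [z8, z7_add_unit7, lieDeriv_z7_add_unit7]
  simp [unit]

/-- The supercapacitor voltage and u₃ act along x₈ alone, so derivatives of functions independent of
x₈ can be computed from `drift`. -/
theorem closedLoop_eq_drift_add (vS : ℝ) (s : AugState) :
    (piBackstepping M r K).closedLoop M vS s =
      M.drift r K s + (1 / M.L8 * vS * M.scLaw r K vS s) • unit 7 := by
  ext i
  · simp only [Prod.fst_add, Pi.add_apply, Prod.smul_fst, Pi.smul_apply, smul_eq_mul, unit,
      Controller.closedLoop, piBackstepping, drift]
    fin_cases i <;> simp [field]
    ring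
  · simp [Controller.closedLoop, piBackstepping, drift, unit]

theorem fderiv_closedLoop_eq_lieDeriv {h : AugState → ℝ}
    (hh : ∀ s (τ : ℝ), h (s + τ • unit 7) = h s) (vS : ℝ) (s : AugState) :
    fderiv ℝ h s ((piBackstepping M r K).closedLoop M vS s) = M.lieDeriv r K h s := by
  rw [closedLoop_eq_drift_add, map_add, map_smul, fderiv_apply_eq_zero_of_invariant hh, smul_zero,
    add_zero]
  rfl

/-! ### Smoothness of the control laws at admissible states -/

variable {M}

theorem contDiffAt_pvLaw {n : WithTop ℕ∞} {s : AugState} (hs : M.Admissible s.1) :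
    ContDiffAt ℝ n (M.pvLaw r K) s := by
  unfold pvLaw v1 z3
  refine ContDiffAt.mul (contDiffAt_const.div (by fun_prop) hs.1) (by fun_prop)

theorem contDiffAt_batLaw {n : WithTop ℕ∞} {s : AugState} (hs : M.Admissible s.1) :
    ContDiffAt ℝ n (M.batLaw r K) s := by
  unfold batLaw v2 z6
  refine ContDiffAt.mul (contDiffAt_const.div (by fun_prop) hs.2.1) (by fun_prop)

theorem contDiffAt_z7 {n : WithTop ℕ∞} {s : AugState} (hs : M.Admissible s.1) :
    ContDiffAt ℝ n (M.z7 r K) s := by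
  have h1 := contDiffAt_pvLaw r K (n := n) hs
  have h2 := contDiffAt_batLaw r K (n := n) hs
  have h3 : ContDiffAt ℝ n (fun s : AugState => 1 / s.1 8) s :=
    contDiffAt_const.div (by fun_prop) hs.2.2
  unfold z7
  simp only [div_eq_mul_inv (_ : ℝ) M.RL]
  fun_prop

theorem contDiffAt_drift {n : WithTop ℕ∞} {s : AugState} (hs : M.Admissible s.1) :
    ContDiffAt ℝ n (M.drift r K) s := by
  have h1 := contDiffAt_pvLaw r K (n := n) hs
  have h2 := contDiffAt_batLaw r K (n := n) hs
  refine ContDiffAt.prodMk (contDiffAt_pi.2 fun i => ?_) (contDiffAt_pi.2 fun i => ?_)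
  · fin_cases i <;> simp [field, div_eq_mul_inv] <;> fun_prop
  · fin_cases i <;> simp [integField, z3, z6] <;> fun_prop

theorem contDiffAt_z8 {n : ℕ} {s : AugState} (hs : M.Admissible s.1) :
    ContDiffAt ℝ n (M.z8 r K) s := by
  have h1 := contDiffAt_z7 r K (n := n) hs
  have h2 : ContDiffAt ℝ n (M.lieDeriv r K (M.z7 r K)) s :=
    -- The Lie derivative costs one order of smoothness, which z₇ has to spare.
    ((contDiffAt_z7 r K (n := (n + 1 : ℕ)) hs).fderiv_right (by norm_cast)).clm_apply
      (contDiffAt_drift r K hs)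
  unfold z8
  fun_prop

/-- The time derivative of a function that does not depend on `x₈`. -/
theorem hasDerivWithinAt_comp_evolution {VS : ℝ → ℝ} {s : ℝ → AugState}
    (hs : (piBackstepping M r K).IsEvolution M VS s) {h : AugState → ℝ}
    (hh : ∀ s (τ : ℝ), h (s + τ • unit 7) = h s) {t : ℝ} (ht : 0 ≤ t)
    (hd : DifferentiableAt ℝ h (s t)) :
    HasDerivWithinAt (fun t => h (s t)) (M.lieDeriv r K h (s t)) (Ici 0) t := by
  rw [← fderiv_closedLoop_eq_lieDeriv M r K hh (VS t)]
  exact hd.hasFDerivAt.comp_hasDerivWithinAt t (hs t ht)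

theorem mul_pvLaw {s : AugState} (hs : M.Admissible s.1) :
    (s.1 1 + (M.R01 - M.R02) * s.1 2) * M.pvLaw r K s =
      -s.1 0 + s.1 1 + M.R01 * s.1 2 - M.L3 * M.v1 r K s := by
  rw [pvLaw, ← mul_assoc, mul_one_div_cancel hs.1, one_mul]

theorem mul_batLaw {s : AugState} (hs : M.Admissible s.1) :
    s.1 4 * M.batLaw r K s = -s.1 3 + s.1 4 + M.R04 * s.1 5 + M.L6 * M.v2 r K s := by
  rw [batLaw, ← mul_assoc, mul_one_div_cancel hs.2.1, one_mul]

/-! ### The equilibrium -/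

theorem mul_pvLaw_xe (hadm : M.Admissible (M.xe r)) :
    (M.x2Star r + (M.R01 - M.R02) * (1 / M.R1 * (M.VPV - r.x1))) * M.pvLaw r K (M.xe r, 0) =
      -r.x1 + M.x2Star r + M.R01 * (1 / M.R1 * (M.VPV - r.x1)) := by
  simpa [v1, z3, xe] using mul_pvLaw r K (s := (M.xe r, 0)) hadm

theorem mul_batLaw_xe (hadm : M.Admissible (M.xe r)) :
    M.x5Star r * M.batLaw r K (M.xe r, 0) =
      -r.x4 + M.x5Star r + M.R04 * (1 / M.R4 * (M.VB - r.x4)) := by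
  simpa [v2, z6, xe] using mul_batLaw r K (s := (M.xe r, 0)) hadm

variable {r K}

theorem quadratic_x2Star (h2 : 0 ≤ M.radicand2 r) :
    (r.x9 - M.x2Star r) * (M.x2Star r + M.a2 r) + M.R2 * M.C2 * M.delta2 r = 0 := by
  have h := Real.sq_sqrt h2
  rw [show M.radicand2 r = (r.x9 - M.a2 r) ^ 2 + 4 * (M.R2 * M.C2 * M.delta2 r + M.a2 r * r.x9)
    from rfl] at h
  unfold x2Star radicand2
  linear_combination -h / 4

theorem quadratic_x5Star (h5 : 0 ≤ M.radicand5 r) :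
    (r.x9 - M.x5Star r) * M.x5Star r + M.R5 * M.C5 * M.delta5 r = 0 := by
  have h := Real.sq_sqrt h5
  rw [show M.radicand5 r = r.x9 ^ 2 + 4 * M.R5 * M.C5 * M.delta5 r from rfl] at h
  unfold x5Star radicand5
  linear_combination -h / 4

/-- Eliminating u₁ between the steady-state equations of x₂ and x₃ leaves exactly the quadratic
solved by x₂*; admissibility of xᵉ allows division by the control denominator. -/
theorem pv_balance_xe (h2 : 0 ≤ M.radicand2 r) (hadm : M.Admissible (M.xe r)) :
    1 / M.R2 * (r.x9 - M.x2Star r)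
      + 1 / M.R1 * (M.VPV - r.x1) * (1 - M.pvLaw r K (M.xe r, 0)) = 0 := by
  have hD : M.x2Star r + M.a2 r ≠ 0 := by
    have := hadm.1
    simp [xe] at this
    unfold a2
    convert this using 2
    ring
  have hu := mul_pvLaw_xe r K hadm
  have hq := quadratic_x2Star h2
  have hR2 := M.R2_pos.ne'
  have hR1 := M.R1_pos.ne'
  have hC2 := M.C2_pos.ne'
  have hd : M.C2 * M.delta2 r = 1 / M.R1 * (M.VPV - r.x1) *
      (r.x1 - M.R02 * (1 / M.R1 * (M.VPV - r.x1))) := by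
    unfold delta2; field_simp
  have ha : M.a2 r = (M.R01 - M.R02) * (1 / M.R1 * (M.VPV - r.x1)) := by
    unfold a2; ring
  apply mul_left_cancel₀ hD
  apply mul_left_cancel₀ hR2
  have : M.R2 * (1 / M.R2) = 1 := by field_simp
  linear_combination hq + (r.x9 - M.x2Star r) * (M.x2Star r + M.a2 r) * this
    - M.R2 * (1 / M.R1 * (M.VPV - r.x1)) * hu - M.R2 * hd
    + M.R2 * (1 / M.R1 * (M.VPV - r.x1)) * (1 - M.pvLaw r K (M.xe r, 0)) * ha

theorem bat_balance_xe (h5 : 0 ≤ M.radicand5 r) (hadm : M.Admissible (M.xe r)) :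
    1 / M.R5 * (r.x9 - M.x5Star r)
      + 1 / M.R4 * (M.VB - r.x4) * (1 - M.batLaw r K (M.xe r, 0)) = 0 := by
  have hD : M.x5Star r ≠ 0 := by
    have := hadm.2.1
    simpa [xe] using this
  have hu := mul_batLaw_xe r K hadm
  have hq := quadratic_x5Star h5
  have hR5 := M.R5_pos.ne'
  have hR4 := M.R4_pos.ne'
  have hC5 := M.C5_pos.ne'
  have hd : M.C5 * M.delta5 r = 1 / M.R4 * (M.VB - r.x4) *
      (r.x4 - M.R04 * (1 / M.R4 * (M.VB - r.x4))) := by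
    unfold delta5; field_simp
  apply mul_left_cancel₀ hD
  apply mul_left_cancel₀ hR5
  have : M.R5 * (1 / M.R5) = 1 := by field_simp
  linear_combination hq + (r.x9 - M.x5Star r) * M.x5Star r * this
    - M.R5 * (1 / M.R4 * (M.VB - r.x4)) * hu - M.R5 * hd

theorem z7_xe (hx9 : 0 < r.x9) (hbal : M.CurrentBalance r) : M.z7 r K (M.xe r, 0) = r.x9 := by
  have hb : r.x9 / M.RL - 1 / M.R2 * (M.x2Star r - r.x9) - 1 / M.R5 * (M.x5Star r - r.x9) = 0 := by
    unfold CurrentBalance at hbal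
    linear_combination hbal
  have h9 := hx9.ne'
  simp only [z7]
  simp only [xe, Matrix.cons_val]
  rw [hb]
  field_simp
  ring

/-- Only the equation of x₈ is unbalanced, because `drift` omits u₃. Functions independent of x₈
therefore have zero Lie derivative at xᵉ, and u₃ cancels what remains. -/
theorem drift_xe (h2 : 0 ≤ M.radicand2 r) (h5 : 0 ≤ M.radicand5 r)
    (hbal : M.CurrentBalance r) (hadm : M.Admissible (M.xe r)) :
    M.drift r K (M.xe r, 0) = (-(r.x9 / M.L8)) • unit 7 := by
  have hpv := pv_balance_xe (K := K) h2 hadm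
  have hbat := bat_balance_xe (K := K) h5 hadm
  have hu1 := mul_pvLaw_xe r K hadm
  have hu2 := mul_batLaw_xe r K hadm
  have hb : r.x9 / M.RL = 1 / M.R2 * (M.x2Star r - r.x9) + 1 / M.R5 * (M.x5Star r - r.x9) := by
    unfold CurrentBalance at hbal
    linear_combination hbal
  simp only [drift]
  generalize M.pvLaw r K (M.xe r, 0) = u1 at *
  generalize M.batLaw r K (M.xe r, 0) = u2 at *
  ext i
  · fin_cases i
    · simp [field, xe, unit]; ring
    · simp [field, xe, unit]
      linear_combination 1 / M.C2 * hpv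
    · simp [field, xe, unit]
      linear_combination 1 / M.L3 * hu1
    · simp [field, xe, unit]; ring
    · simp [field, xe, unit]
      linear_combination 1 / M.C5 * hbat
    · simp [field, xe, unit]
      linear_combination 1 / M.L6 * hu2
    · simp [field, xe, unit]
    · simp [field, xe, unit]; ring
    · simp [field, xe, unit]
      right
      linear_combination -hb
  · fin_cases i <;> simp [integField, z3, z6, xe, unit]

theorem lieDeriv_xe (h2 : 0 ≤ M.radicand2 r) (h5 : 0 ≤ M.radicand5 r)
    (hbal : M.CurrentBalance r) (hadm : M.Admissible (M.xe r)) {h : AugState → ℝ}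
    (hh : ∀ s (τ : ℝ), h (s + τ • unit 7) = h s) : M.lieDeriv r K h (M.xe r, 0) = 0 := by
  change fderiv ℝ h _ (M.drift r K (M.xe r, 0)) = 0
  rw [drift_xe h2 h5 hbal hadm, map_smul, fderiv_apply_eq_zero_of_invariant hh, smul_zero]

theorem z8_xe (hx9 : 0 < r.x9) (h2 : 0 ≤ M.radicand2 r) (h5 : 0 ≤ M.radicand5 r)
    (hbal : M.CurrentBalance r) (hadm : M.Admissible (M.xe r)) : M.z8 r K (M.xe r, 0) = 0 := by
  rw [z8, z7_xe hx9 hbal, lieDeriv_xe h2 h5 hbal hadm (M.z7_add_unit7 r K)]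
  simp [xe]

theorem closedLoop_xe (hx9 : 0 < r.x9) (h2 : 0 ≤ M.radicand2 r) (h5 : 0 ≤ M.radicand5 r)
    (hbal : M.CurrentBalance r) (hadm : M.Admissible (M.xe r)) {vS : ℝ} (hvS : 0 < vS) :
    (piBackstepping M r K).closedLoop M vS (M.xe r, 0) = 0 := by
  rw [closedLoop_eq_drift_add, drift_xe h2 h5 hbal hadm, ← add_smul, scLaw,
    lieDeriv_xe h2 h5 hbal hadm (M.z8_add_unit7 r K), z8_xe hx9 h2 h5 hbal hadm]
  have := hvS.ne'
  have hc : -(r.x9 / M.L8) + 1 / M.L8 * vS * (1 / vS * (M.xe r 6 + M.R08 * M.xe r 7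
      + M.L8 * 0 - M.L8 * K.K8 * (M.xe r 7 - 0))) = 0 := by
    simp [xe]
    field_simp
    ring
  simp only [hc, zero_smul]

end Microgrid

/-! ### Linear error cascades and the choice of gains -/

theorem tendsto_zero_of_sq_le {ι : Type*} {l : Filter ι} {y q : ι → ℝ} {c : ℝ}
    (h : ∀ t, y t ^ 2 ≤ c * q t) (hq : Tendsto q l (𝓝 0)) : Tendsto y l (𝓝 0) := by
  refine squeeze_zero_norm (fun t => (Real.norm_eq_abs _).trans_le (Real.abs_le_sqrt (h t))) ?_
  have := (Real.continuous_sqrt.tendsto (c * 0)).comp (hq.const_mul c)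
  simpa [Function.comp_def] using this

/-- A cascade of two linear systems with integral action. -/
theorem tendsto_zero_of_pi_cascade {e₁ a₁ e₃ a₃ : ℝ → ℝ} {b κ : ℝ} (hκ : 0 < κ)
    (he₁ : ∀ t, 0 ≤ t → HasDerivWithinAt e₁ (-2 * e₁ t - a₁ t + b * e₃ t) (Ici 0) t)
    (ha₁ : ∀ t, 0 ≤ t → HasDerivWithinAt a₁ (e₁ t) (Ici 0) t)
    (he₃ : ∀ t, 0 ≤ t → HasDerivWithinAt e₃ (-(κ + 1) * e₃ t - κ * a₃ t) (Ici 0) t)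
    (ha₃ : ∀ t, 0 ≤ t → HasDerivWithinAt a₃ (e₃ t) (Ici 0) t) :
    Tendsto e₁ atTop (𝓝 0) ∧ Tendsto a₁ atTop (𝓝 0) ∧
      Tendsto e₃ atTop (𝓝 0) ∧ Tendsto a₃ atTop (𝓝 0) := by
  -- The characteristic polynomials are (λ + 1)(λ + κ) and (λ + 1)². The common root -1 makes each
  -- sum e + a obey a scalar equation, which then drives a' = -a + (e + a).
  have hp₃ : Tendsto (fun t => e₃ t + a₃ t) atTop (𝓝 0) :=
    tendsto_zero_of_linear_ode (d := fun _ => 0) hκ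
      (fun t ht => ((he₃ t ht).fun_add (ha₃ t ht)).congr_deriv (by ring)) tendsto_const_nhds
  have h₃ : Tendsto a₃ atTop (𝓝 0) :=
    tendsto_zero_of_linear_ode one_pos (fun t ht => (ha₃ t ht).congr_deriv (by ring)) hp₃
  have h₃' : Tendsto e₃ atTop (𝓝 0) := by simpa using hp₃.sub h₃
  have hp₁ : Tendsto (fun t => e₁ t + a₁ t) atTop (𝓝 0) :=
    tendsto_zero_of_linear_ode (d := fun t => b * e₃ t) one_pos
      (fun t ht => ((he₁ t ht).fun_add (ha₁ t ht)).congr_deriv (by ring))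
      (by simpa using h₃'.const_mul b)
  have h₁ : Tendsto a₁ atTop (𝓝 0) :=
    tendsto_zero_of_linear_ode one_pos (fun t ht => (ha₁ t ht).congr_deriv (by ring)) hp₁
  exact ⟨by simpa using hp₁.sub h₁, h₁, h₃', h₃⟩

namespace Microgrid

variable (M : Microgrid)

/-- Gains for which the error dynamics of both converters are stable cascades. -/
def stableGains : Gains where
  K1 := 2
  Kbar1 := 1
  Kal1 := 1
  K3 := 4
  -- The derivative of z₃ feeds (2 - 1/(R₁C₁))e₃ back into e₃', so `K3 := 4` leaves the coefficient
  -- -(κ + 1) with κ = 1 + 1/(R₁C₁), and κ is the matching integral gain. The battery gains arise in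
  -- the same way.
  Kbar3 := 1 + 1 / (M.R1 * M.C1)
  Kal3 := 1
  K4 := 2
  Kbar4 := 1
  Kal4 := 1
  K6 := 4
  Kbar6 := 1 + 1 / (M.R4 * M.C4)
  Kal6 := 1
  K7 := 1
  K8 := 1

theorem stableGains_positive : M.stableGains.Positive := by
  have h1 := mul_pos M.R1_pos M.C1_pos
  have h2 := mul_pos M.R4_pos M.C4_pos
  simp only [Gains.Positive, stableGains]
  refine ⟨⟨?_, ?_, ?_, ?_, ?_, ?_⟩, ⟨?_, ?_, ?_, ?_, ?_, ?_⟩, ?_, ?_⟩ <;> positivity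

variable {M} {r : References} {K : Gains}

/-! ### Closed-loop equations in error coordinates and the energy of the bus -/

theorem drift_zero (s : AugState) :
    (M.drift r K s).1 0 =
      -K.K1 * (s.1 0 - r.x1) - K.Kbar1 * s.2 0 - 1 / M.C1 * (s.1 2 - M.z3 r K s) := by
  have hC : M.C1 * (1 / M.C1) = 1 := mul_one_div_cancel M.C1_pos.ne'
  have hR : 1 / (M.R1 * M.C1) = 1 / M.R1 * (1 / M.C1) := by rw [one_div_mul_one_div]
  simp only [drift, field, z3, Matrix.cons_val_zero, hR]
  linear_combination (-K.K1 * (s.1 0 - r.x1) - K.Kbar1 * s.2 0) * hC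

theorem drift_two {s : AugState} (hs : M.Admissible s.1) :
    (M.drift r K s).1 2 = -M.v1 r K s := by
  have hL : M.L3 * (1 / M.L3) = 1 := mul_one_div_cancel M.L3_pos.ne'
  simp only [drift, field, Matrix.cons_val]
  linear_combination 1 / M.L3 * mul_pvLaw r K hs - M.v1 r K s * hL

theorem drift_three (s : AugState) :
    (M.drift r K s).1 3 =
      -K.K4 * (s.1 3 - r.x4) - K.Kbar4 * s.2 2 - 1 / M.C4 * (s.1 5 - M.z6 r K s) := by
  have hC : M.C4 * (1 / M.C4) = 1 := mul_one_div_cancel M.C4_pos.ne'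
  have hR : 1 / (M.R4 * M.C4) = 1 / M.R4 * (1 / M.C4) := by rw [one_div_mul_one_div]
  simp only [drift, field, z6, Matrix.cons_val, hR]
  linear_combination (-K.K4 * (s.1 3 - r.x4) - K.Kbar4 * s.2 2) * hC

theorem drift_five {s : AugState} (hs : M.Admissible s.1) :
    (M.drift r K s).1 5 = M.v2 r K s := by
  have hL : M.L6 * (1 / M.L6) = 1 := mul_one_div_cancel M.L6_pos.ne'
  simp only [drift, field, Matrix.cons_val]
  linear_combination 1 / M.L6 * mul_batLaw r K hs + M.v2 r K s * hL

theorem mul_z7 {s : AugState} (hs : M.Admissible s.1) :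
    s.1 8 * M.z7 r K s =
      -M.R7 * ((s.1 1 - M.x2Star r) *
        (1 / M.R2 * (s.1 8 - M.x2Star r) + s.1 2 * (1 - M.pvLaw r K s)))
      - M.R7 * ((s.1 4 - M.x5Star r) *
        (1 / M.R5 * (s.1 8 - M.x5Star r) + s.1 5 * (1 - M.batLaw r K s)))
      + M.R7 * s.1 8 * (s.1 8 / M.RL - 1 / M.R2 * (s.1 1 - s.1 8) - 1 / M.R5 * (s.1 4 - s.1 8))
      + (-r.x9 ^ 2 + 2 * s.1 8 * r.x9) := by
  have h : s.1 8 * (1 / s.1 8) = 1 := mul_one_div_cancel hs.2.2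
  unfold z7
  linear_combination (-M.R7 * ((s.1 1 - M.x2Star r) *
        (1 / M.R2 * (s.1 8 - M.x2Star r) + s.1 2 * (1 - M.pvLaw r K s)))
      - M.R7 * ((s.1 4 - M.x5Star r) *
        (1 / M.R5 * (s.1 8 - M.x5Star r) + s.1 5 * (1 - M.batLaw r K s)))
      + (-r.x9 ^ 2 + 2 * s.1 8 * r.x9)) * h

variable (M r) in
/-- The dissipation rate of the storage function of the DC bus. -/
def busDissipation (x : GridState) : ℝ :=
  1 / M.R2 * (x 1 - M.x2Star r) ^ 2 + 1 / M.R5 * (x 4 - M.x5Star r) ^ 2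
    + 1 / M.R7 * (x 8 - r.x9) ^ 2

theorem busDissipation_nonneg (x : GridState) : 0 ≤ M.busDissipation r x := by
  have := M.R2_pos
  have := M.R5_pos
  have := M.R7_pos
  unfold busDissipation
  positivity

/-- The power balance of the DC bus. -/
theorem bus_power_balance {s : AugState} (hs : M.Admissible s.1) :
    M.C2 * (s.1 1 - M.x2Star r) * (M.drift r K s).1 1
      + M.C5 * (s.1 4 - M.x5Star r) * (M.drift r K s).1 4 + M.C9 * s.1 8 * (M.drift r K s).1 8 =
    -M.busDissipation r s.1 + 1 / M.R7 * s.1 8 * (s.1 6 - M.z7 r K s) := by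
  have hC2 : M.C2 * (1 / M.C2) = 1 := mul_one_div_cancel M.C2_pos.ne'
  have hC5 : M.C5 * (1 / M.C5) = 1 := mul_one_div_cancel M.C5_pos.ne'
  have hC9 : M.C9 * (1 / M.C9) = 1 := mul_one_div_cancel M.C9_pos.ne'
  have hR7 : 1 / M.R7 * M.R7 = 1 := one_div_mul_cancel M.R7_pos.ne'
  have h1 : M.C2 * (M.drift r K s).1 1 =
      1 / M.R2 * (s.1 8 - s.1 1) + s.1 2 * (1 - M.pvLaw r K s) := by
    have hR : 1 / (M.R2 * M.C2) = 1 / M.R2 * (1 / M.C2) := by rw [one_div_mul_one_div]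
    simp only [drift, field, Matrix.cons_val, hR]
    linear_combination (1 / M.R2 * (s.1 8 - s.1 1) + s.1 2 * (1 - M.pvLaw r K s)) * hC2
  have h4 : M.C5 * (M.drift r K s).1 4 =
      1 / M.R5 * (s.1 8 - s.1 4) + s.1 5 * (1 - M.batLaw r K s) := by
    have hR : 1 / (M.R5 * M.C5) = 1 / M.R5 * (1 / M.C5) := by rw [one_div_mul_one_div]
    simp only [drift, field, Matrix.cons_val, hR]
    linear_combination (1 / M.R5 * (s.1 8 - s.1 4) + s.1 5 * (1 - M.batLaw r K s)) * hC5
  have h8 : M.C9 * (M.drift r K s).1 8 = (s.1 1 - s.1 8) / M.R2 + (s.1 4 - s.1 8) / M.R5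
      + (s.1 6 - s.1 8) / M.R7 - s.1 8 * (1 / M.RL) := by
    simp only [drift, field, Matrix.cons_val]
    rw [← mul_assoc, hC9, one_mul]
  have hz := mul_z7 (r := r) (K := K) hs
  unfold busDissipation
  -- Writing x₉ - x₂ = (x₉ - x₂*) - (x₂ - x₂*), and likewise for x₅, splits off the squares. The
  -- term x₉z₇/R₇ cancels the indefinite rest and completes -(x₉ - x₉*)²/R₇.
  linear_combination (s.1 1 - M.x2Star r) * h1 + (s.1 4 - M.x5Star r) * h4 + s.1 8 * h8
    + 1 / M.R7 * hz + (-((s.1 1 - M.x2Star r) *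
        (1 / M.R2 * (s.1 8 - M.x2Star r) + s.1 2 * (1 - M.pvLaw r K s)))
      - ((s.1 4 - M.x5Star r) *
        (1 / M.R5 * (s.1 8 - M.x5Star r) + s.1 5 * (1 - M.batLaw r K s)))
      + s.1 8 * (s.1 8 / M.RL - 1 / M.R2 * (s.1 1 - s.1 8) - 1 / M.R5 * (s.1 4 - s.1 8))) * hR7

/-! ### Evolutions of the closed loop -/

section Evolution

variable {VS : ℝ → ℝ} {s : ℝ → AugState}

theorem hasDerivWithinAt_state (hs : (piBackstepping M r K).IsEvolution M VS s) {t : ℝ}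
    (ht : 0 ≤ t) {i : Fin 9} (hi : i ≠ 7) :
    HasDerivWithinAt (fun t => (s t).1 i) ((M.drift r K (s t)).1 i) (Ici 0) t := by
  have h := hasDerivWithinAt_pi.1 (hs t ht).fst i
  rw [closedLoop_eq_drift_add] at h
  simpa [unit, Pi.single_apply, hi] using h

theorem hasDerivWithinAt_integ (hs : (piBackstepping M r K).IsEvolution M VS s) {t : ℝ}
    (ht : 0 ≤ t) (i : Fin 4) :
    HasDerivWithinAt (fun t => (s t).2 i) (M.integField r K (s t) i) (Ici 0) t :=
  hasDerivWithinAt_pi.1 (hs t ht).snd i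

theorem tendsto_pv (hs : (piBackstepping M r M.stableGains).IsEvolution M VS s)
    (hadm : ∀ t, 0 ≤ t → M.Admissible (s t).1) :
    Tendsto (fun t => (s t).1 0) atTop (𝓝 r.x1) ∧
    Tendsto (fun t => (s t).1 2) atTop (𝓝 (1 / M.R1 * (M.VPV - r.x1))) ∧
    Tendsto (fun t => (s t).2 0) atTop (𝓝 0) ∧ Tendsto (fun t => (s t).2 1) atTop (𝓝 0) := by
  have hC : M.C1 * (1 / M.C1) = 1 := mul_one_div_cancel M.C1_pos.ne'
  have hR : 1 / (M.R1 * M.C1) = 1 / M.R1 * (1 / M.C1) := by rw [one_div_mul_one_div]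
  have hpos := mul_pos M.R1_pos M.C1_pos
  have hx t (ht : 0 ≤ t) := hasDerivWithinAt_state hs ht (i := 0) (by decide)
  have ha t (ht : 0 ≤ t) := hasDerivWithinAt_integ hs ht 0
  have hz (t) (ht : 0 ≤ t) : HasDerivWithinAt (fun t => M.z3 r M.stableGains (s t))
      ((2 * M.C1 - 1 / M.R1) * (M.drift r M.stableGains (s t)).1 0
        + M.C1 * ((s t).1 0 - r.x1)) (Ici 0) t := by
    refine (((((hx t ht).const_sub M.VPV).const_mul (1 / M.R1)).fun_add
      (((hx t ht).sub_const r.x1).const_mul (M.C1 * M.stableGains.K1))).fun_add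
      ((ha t ht).const_mul (M.C1 * M.stableGains.Kbar1))).congr_deriv ?_
    simp only [integField, stableGains, Matrix.cons_val]
    ring
  obtain ⟨h1, h2, h3, h4⟩ := tendsto_zero_of_pi_cascade
    (e₁ := fun t => (s t).1 0 - r.x1) (a₁ := fun t => (s t).2 0)
    (e₃ := fun t => (s t).1 2 - M.z3 r M.stableGains (s t)) (a₃ := fun t => (s t).2 1)
    (b := -(1 / M.C1)) (κ := 1 + 1 / (M.R1 * M.C1)) (by positivity)
    (fun t ht => ((hx t ht).sub_const r.x1).congr_deriv (by
      rw [drift_zero]; simp only [stableGains]; ring))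
    (fun t ht => (ha t ht).congr_deriv (by simp [integField, stableGains]))
    (fun t ht => ((hasDerivWithinAt_state hs ht (i := 2) (by decide)).fun_sub
      (hz t ht)).congr_deriv (by
        rw [drift_zero, drift_two (hadm t ht), v1]
        generalize M.z3 r M.stableGains (s t) = z
        simp only [stableGains, hR]
        linear_combination 2 * ((s t).1 2 - z) * hC))
    (fun t ht => (hasDerivWithinAt_integ hs ht 1).congr_deriv (by simp [integField, stableGains]))
  have h0 : Tendsto (fun t => (s t).1 0) atTop (𝓝 r.x1) := by simpa using h1.add_const r.x1
  refine ⟨h0, ?_, h2, h4⟩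
  -- x₃ is recovered as (x₃ - z₃) + z₃.
  have h := ((h3.add ((h0.const_sub M.VPV).const_mul (1 / M.R1))).add
    (h1.const_mul (M.C1 * M.stableGains.K1))).add (h2.const_mul (M.C1 * M.stableGains.Kbar1))
  simp only [mul_zero, add_zero, zero_add] at h
  refine h.congr fun t => ?_
  simp only [z3]
  ring

theorem tendsto_bat (hs : (piBackstepping M r M.stableGains).IsEvolution M VS s)
    (hadm : ∀ t, 0 ≤ t → M.Admissible (s t).1) :
    Tendsto (fun t => (s t).1 3) atTop (𝓝 r.x4) ∧
    Tendsto (fun t => (s t).1 5) atTop (𝓝 (1 / M.R4 * (M.VB - r.x4))) ∧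
    Tendsto (fun t => (s t).2 2) atTop (𝓝 0) ∧ Tendsto (fun t => (s t).2 3) atTop (𝓝 0) := by
  have hC : M.C4 * (1 / M.C4) = 1 := mul_one_div_cancel M.C4_pos.ne'
  have hR : 1 / (M.R4 * M.C4) = 1 / M.R4 * (1 / M.C4) := by rw [one_div_mul_one_div]
  have hpos := mul_pos M.R4_pos M.C4_pos
  have hx t (ht : 0 ≤ t) := hasDerivWithinAt_state hs ht (i := 3) (by decide)
  have ha t (ht : 0 ≤ t) := hasDerivWithinAt_integ hs ht 2
  have hz (t) (ht : 0 ≤ t) : HasDerivWithinAt (fun t => M.z6 r M.stableGains (s t))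
      ((2 * M.C4 - 1 / M.R4) * (M.drift r M.stableGains (s t)).1 3
        + M.C4 * ((s t).1 3 - r.x4)) (Ici 0) t := by
    refine (((((hx t ht).const_sub M.VB).const_mul (1 / M.R4)).fun_add
      (((hx t ht).sub_const r.x4).const_mul (M.C4 * M.stableGains.K4))).fun_add
      ((ha t ht).const_mul (M.C4 * M.stableGains.Kbar4))).congr_deriv ?_
    simp only [integField, stableGains, Matrix.cons_val]
    ring
  obtain ⟨h1, h2, h3, h4⟩ := tendsto_zero_of_pi_cascade
    (e₁ := fun t => (s t).1 3 - r.x4) (a₁ := fun t => (s t).2 2)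
    (e₃ := fun t => (s t).1 5 - M.z6 r M.stableGains (s t)) (a₃ := fun t => (s t).2 3)
    (b := -(1 / M.C4)) (κ := 1 + 1 / (M.R4 * M.C4)) (by positivity)
    (fun t ht => ((hx t ht).sub_const r.x4).congr_deriv (by
      rw [drift_three]; simp only [stableGains]; ring))
    (fun t ht => (ha t ht).congr_deriv (by simp [integField, stableGains]))
    (fun t ht => ((hasDerivWithinAt_state hs ht (i := 5) (by decide)).fun_sub
      (hz t ht)).congr_deriv (by
        rw [drift_three, drift_five (hadm t ht), v2]
        generalize M.z6 r M.stableGains (s t) = z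
        simp only [stableGains, hR]
        linear_combination 2 * ((s t).1 5 - z) * hC))
    (fun t ht => (hasDerivWithinAt_integ hs ht 3).congr_deriv (by simp [integField, stableGains]))
  have h0 : Tendsto (fun t => (s t).1 3) atTop (𝓝 r.x4) := by simpa using h1.add_const r.x4
  refine ⟨h0, ?_, h2, h4⟩
  have h := ((h3.add ((h0.const_sub M.VB).const_mul (1 / M.R4))).add
    (h1.const_mul (M.C4 * M.stableGains.K4))).add (h2.const_mul (M.C4 * M.stableGains.Kbar4))
  simp only [mul_zero, add_zero, zero_add] at h
  refine h.congr fun t => ?_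
  simp only [z6]
  ring

theorem hasDerivWithinAt_e7 (hs : (piBackstepping M r K).IsEvolution M VS s)
    (hadm : ∀ t, 0 ≤ t → M.Admissible (s t).1) {t : ℝ} (ht : 0 ≤ t) :
    HasDerivWithinAt (fun t => (s t).1 6 - M.z7 r K (s t))
      (-K.K7 * ((s t).1 6 - M.z7 r K (s t))
        - 1 / M.C7 * ((s t).1 7 - M.z8 r K (s t))) (Ici 0) t := by
  have hC : M.C7 * (1 / M.C7) = 1 := mul_one_div_cancel M.C7_pos.ne'
  have hR : 1 / (M.R7 * M.C7) = 1 / M.R7 * (1 / M.C7) := by rw [one_div_mul_one_div]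
  refine ((hasDerivWithinAt_state hs ht (i := 6) (by decide)).fun_sub
    (hasDerivWithinAt_comp_evolution r K hs (M.z7_add_unit7 r K) ht
      ((contDiffAt_z7 r K (n := 1) (hadm t ht)).differentiableAt one_ne_zero))).congr_deriv ?_
  simp only [z8, drift, field, Matrix.cons_val, hR]
  linear_combination (M.lieDeriv r K (M.z7 r K) (s t)
    - K.K7 * ((s t).1 6 - M.z7 r K (s t))) * hC

theorem hasDerivWithinAt_e8 (hs : (piBackstepping M r K).IsEvolution M VS s)
    (hadm : ∀ t, 0 ≤ t → M.Admissible (s t).1) (hVS : ∀ t, 0 ≤ t → 0 < VS t) {t : ℝ}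
    (ht : 0 ≤ t) :
    HasDerivWithinAt (fun t => (s t).1 7 - M.z8 r K (s t))
      (-K.K8 * ((s t).1 7 - M.z8 r K (s t))) (Ici 0) t := by
  have hL : 1 / M.L8 * M.L8 = 1 := one_div_mul_cancel M.L8_pos.ne'
  have hV : VS t * (1 / VS t) = 1 := mul_one_div_cancel (hVS t ht).ne'
  refine ((hasDerivWithinAt_pi.1 (hs t ht).fst 7).fun_sub
    (hasDerivWithinAt_comp_evolution r K hs (M.z8_add_unit7 r K) ht
      ((contDiffAt_z8 r K (n := 1) (hadm t ht)).differentiableAt one_ne_zero))).congr_deriv ?_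
  simp only [Controller.closedLoop, piBackstepping, scLaw, field, Matrix.cons_val,
    div_eq_mul_one_div M.R08]
  generalize M.lieDeriv r K (M.z8 r K) (s t) = w
  generalize M.z8 r K (s t) = z
  linear_combination (1 / M.L8 * ((s t).1 6 + M.R08 * (s t).1 7 + M.L8 * w
    - M.L8 * K.K8 * ((s t).1 7 - z))) * hV + (w - K.K8 * ((s t).1 7 - z)) * hL

theorem tendsto_e8 (hs : (piBackstepping M r M.stableGains).IsEvolution M VS s)
    (hadm : ∀ t, 0 ≤ t → M.Admissible (s t).1) (hVS : ∀ t, 0 ≤ t → 0 < VS t) :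
    Tendsto (fun t => (s t).1 7 - M.z8 r M.stableGains (s t)) atTop (𝓝 0) :=
  tendsto_zero_of_linear_ode (d := fun _ => 0) one_pos
    (fun t ht => (hasDerivWithinAt_e8 hs hadm hVS ht).congr_deriv (by simp [stableGains]))
    tendsto_const_nhds

theorem tendsto_e7 (hs : (piBackstepping M r M.stableGains).IsEvolution M VS s)
    (hadm : ∀ t, 0 ≤ t → M.Admissible (s t).1) (hVS : ∀ t, 0 ≤ t → 0 < VS t) :
    Tendsto (fun t => (s t).1 6 - M.z7 r M.stableGains (s t)) atTop (𝓝 0) :=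
  tendsto_zero_of_linear_ode
    (d := fun t => -(1 / M.C7) * ((s t).1 7 - M.z8 r M.stableGains (s t))) one_pos
    (fun t ht => (hasDerivWithinAt_e7 hs hadm ht).congr_deriv (by
      simp only [stableGains]; ring))
    (by simpa using (tendsto_e8 hs hadm hVS).const_mul (-(1 / M.C7)))

end Evolution

/-- If the components other than `x₇` and `x₈` converge to the equilibrium and `x₇ - z₇` vanishes
in the limit, then the state with `x₈` reset to `0` converges to the equilibrium. -/
theorem tendsto_reset_xe {ι : Type*} {l : Filter ι} {s : ι → AugState} (hx9 : 0 < r.x9)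
    (hbal : M.CurrentBalance r) (hadm : M.Admissible (M.xe r))
    (hx : ∀ i, i ≠ 6 → i ≠ 7 → Tendsto (fun t => (s t).1 i) l (𝓝 (M.xe r i)))
    (ha : ∀ i, Tendsto (fun t => (s t).2 i) l (𝓝 0))
    (h7 : Tendsto (fun t => (s t).1 6 - M.z7 r K (s t)) l (𝓝 0)) :
    Tendsto (fun t => s t + (-(s t).1 7) • unit 7) l (𝓝 (M.xe r, 0)) := by
  have hz : Tendsto (fun t => M.z7 r K (s t)) l (𝓝 r.x9) := by
    -- As z₇ ignores x₇ and x₈, both may be replaced by their equilibrium values before anything is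
    -- known about them.
    have hw : Tendsto (fun t => s t + (r.x9 - (s t).1 6) • unit 6 + (-(s t).1 7) • unit 7) l
        (𝓝 (M.xe r, 0)) := by
      refine Tendsto.prodMk_nhds (tendsto_pi_nhds.2 fun i => ?_) (tendsto_pi_nhds.2 fun i => ?_)
      · by_cases h6 : i = 6
        · subst h6
          simpa [unit, xe] using tendsto_const_nhds
        · by_cases h7 : i = 7
          · subst h7
            simpa [unit, xe] using tendsto_const_nhds
          · simpa [unit, Pi.single_apply, h6, h7] using hx i h6 h7
      · simpa [unit] using ha i
    have h := ((contDiffAt_z7 r K (n := 0) (s := (M.xe r, 0)) hadm).continuousAt.tendsto).comp hw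
    rw [z7_xe hx9 hbal] at h
    exact h.congr fun t => by simp only [Function.comp_apply, z7_add_unit7, z7_add_unit6]
  have h6 : Tendsto (fun t => (s t).1 6) l (𝓝 r.x9) := by simpa using h7.add hz
  refine Tendsto.prodMk_nhds (tendsto_pi_nhds.2 fun i => ?_) (tendsto_pi_nhds.2 fun i => ?_)
  · by_cases hi : i = 7
    · subst hi
      simpa [unit, xe] using tendsto_const_nhds
    · by_cases hi' : i = 6
      · subst hi'
        simpa [unit, xe] using h6
      · simpa [unit, Pi.single_apply, hi] using hx i hi' hi
  · simpa [unit] using ha i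

theorem tendsto_of_busDissipation {ι : Type*} {l : Filter ι} {x : ι → GridState}
    (h : Tendsto (fun t => M.busDissipation r (x t)) l (𝓝 0)) :
    Tendsto (fun t => x t 1) l (𝓝 (M.x2Star r)) ∧ Tendsto (fun t => x t 4) l (𝓝 (M.x5Star r)) ∧
      Tendsto (fun t => x t 8) l (𝓝 r.x9) := by
  have hR2 := M.R2_pos
  have hR5 := M.R5_pos
  have hR7 := M.R7_pos
  have key {i : Fin 9} {a R : ℝ} (hR : 0 < R)
      (hle : ∀ t, 1 / R * (x t i - a) ^ 2 ≤ M.busDissipation r (x t)) :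
      Tendsto (fun t => x t i) l (𝓝 a) := by
    have : Tendsto (fun t => x t i - a) l (𝓝 0) := by
      refine tendsto_zero_of_sq_le (c := R) (fun t => ?_) h
      have := mul_le_mul_of_nonneg_left (hle t) hR.le
      rwa [← mul_assoc, mul_one_div_cancel hR.ne', one_mul] at this
    simpa using this.add_const a
  have h1 t : 0 ≤ 1 / M.R2 * (x t 1 - M.x2Star r) ^ 2 := by positivity
  have h4 t : 0 ≤ 1 / M.R5 * (x t 4 - M.x5Star r) ^ 2 := by positivity
  have h8 t : 0 ≤ 1 / M.R7 * (x t 8 - r.x9) ^ 2 := by positivity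
  refine ⟨key hR2 fun t => ?_, key hR5 fun t => ?_, key hR7 fun t => ?_⟩ <;>
    · unfold busDissipation
      linarith [h1 t, h4 t, h8 t]

/-! ### Lyapunov argument for the bus voltages -/

variable {VS : ℝ → ℝ} {s : ℝ → AugState}

variable (M r) in
/-- The derivative of `busDissipation` along the closed loop. -/
def busDissipationRate (s : AugState) : ℝ :=
  2 / M.R2 * (s.1 1 - M.x2Star r) * (M.drift r M.stableGains s).1 1
    + 2 / M.R5 * (s.1 4 - M.x5Star r) * (M.drift r M.stableGains s).1 4
    + 2 / M.R7 * (s.1 8 - r.x9) * (M.drift r M.stableGains s).1 8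

theorem busDissipationRate_add_unit7 (s : AugState) (τ : ℝ) :
    M.busDissipationRate r (s + τ • unit 7) = M.busDissipationRate r s := by
  simp only [busDissipationRate, drift_add_unit7]
  simp [unit]

theorem tendsto_busDissipation (hx9 : 0 < r.x9) (hbal : M.CurrentBalance r)
    (hadm : M.Admissible (M.xe r)) (hVS : ∀ t, 0 ≤ t → 0 < VS t)
    (hs : (piBackstepping M r M.stableGains).IsEvolution M VS s)
    (hsadm : ∀ t, 0 ≤ t → M.Admissible (s t).1)
    (hlin : ∀ i, i ≠ 6 → i ≠ 7 → i ≠ 1 → i ≠ 4 → i ≠ 8 →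
      Tendsto (fun t => (s t).1 i) atTop (𝓝 (M.xe r i)))
    (ha : ∀ i, Tendsto (fun t => (s t).2 i) atTop (𝓝 0)) :
    Tendsto (fun t => M.busDissipation r (s t).1) atTop (𝓝 0) := by
  set K := M.stableGains with hK
  have hR7 := M.R7_pos
  have hR2 := M.R2_pos
  have hR5 := M.R5_pos
  have hC2 := M.C2_pos
  have hC5 := M.C5_pos
  have hC9 := M.C9_pos
  have hx1 t (ht : 0 ≤ t) := hasDerivWithinAt_state hs ht (i := 1) (by decide)
  have hx4 t (ht : 0 ≤ t) := hasDerivWithinAt_state hs ht (i := 4) (by decide)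
  have hx8 t (ht : 0 ≤ t) := hasDerivWithinAt_state hs ht (i := 8) (by decide)
  let e7 : ℝ → ℝ := fun t => (s t).1 6 - M.z7 r K (s t)
  -- With this scaling e₇' = -e₇ - e₈ and e₈' = -e₈, hence (e₇ - e₈)' = -e₇.
  let e8 : ℝ → ℝ := fun t => 1 / M.C7 * ((s t).1 7 - M.z8 r K (s t))
  have he7 t (ht : 0 ≤ t) : HasDerivWithinAt e7 (-e7 t - e8 t) (Ici 0) t :=
    (hasDerivWithinAt_e7 hs hsadm ht).congr_deriv (by
      simp only [e7, e8, hK, stableGains]; ring)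
  have he8 t (ht : 0 ≤ t) : HasDerivWithinAt e8 (-e8 t) (Ici 0) t :=
    ((hasDerivWithinAt_e8 hs hsadm hVS ht).const_mul (1 / M.C7)).congr_deriv (by
      simp only [e8, hK, stableGains]; ring)
  refine tendsto_zero_of_dissipation (q' := fun t => M.busDissipationRate r (s t)) (c := 1 / 2)
    (m := -(3 / 2 * (1 / M.R7) * r.x9 ^ 2))
    -- Split x₉e₇ = x₉*e₇ + (x₉ - x₉*)e₇. The linear term in e₇ - e₈ cancels the first part exactly;
    -- the quadratic terms supply the e₇² that dominates the second.
    (U := fun t => 1 / 2 * (M.C2 * ((s t).1 1 - M.x2Star r) ^ 2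
      + M.C5 * ((s t).1 4 - M.x5Star r) ^ 2 + M.C9 * (s t).1 8 ^ 2)
      + (1 / M.R7 * r.x9 * (e7 t - e8 t) + 1 / 2 * (1 / M.R7) * (e7 t ^ 2 + 1 / 2 * e8 t ^ 2)))
    (U' := fun t => -M.busDissipation r (s t).1 + 1 / M.R7 * ((s t).1 8 - r.x9) * e7 t
      - 1 / 2 * (1 / M.R7) * (e7 t ^ 2 + (e7 t + e8 t) ^ 2))
    (by norm_num) (fun t ht => ?_) (fun t ht => ?_) (fun t ht => ?_) (fun t ht => ?_)
    (fun t => busDissipation_nonneg _) ?_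
  · refine ((((((hx1 t ht).sub_const (M.x2Star r)).fun_pow 2).const_mul (1 / M.R2)).fun_add
      ((((hx4 t ht).sub_const (M.x5Star r)).fun_pow 2).const_mul (1 / M.R5))).fun_add
      ((((hx8 t ht).sub_const r.x9).fun_pow 2).const_mul (1 / M.R7))).congr_deriv ?_
    simp only [busDissipationRate]
    push_cast
    ring
  · refine ((((((((hx1 t ht).sub_const (M.x2Star r)).fun_pow 2).const_mul M.C2).fun_add
      ((((hx4 t ht).sub_const (M.x5Star r)).fun_pow 2).const_mul M.C5)).fun_add
      (((hx8 t ht).fun_pow 2).const_mul M.C9)).const_mul (1 / 2)).fun_add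
      ((((he7 t ht).fun_sub (he8 t ht)).const_mul (1 / M.R7 * r.x9)).fun_add
      ((((he7 t ht).fun_pow 2).fun_add (((he8 t ht).fun_pow 2).const_mul (1 / 2))).const_mul
        (1 / 2 * (1 / M.R7))))).congr_deriv ?_
    have hb := bus_power_balance (r := r) (K := K) (hsadm t ht)
    change _ = _ + 1 / M.R7 * (s t).1 8 * e7 t at hb
    push_cast
    linear_combination hb
  -- Young's inequality for (x₉ - x₉*)e₇ uses up half of the dissipation in x₉, hence c = 1/2.
  · have h1 : 0 ≤ 1 / M.R2 * ((s t).1 1 - M.x2Star r) ^ 2 := by positivity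
    have h4 : 0 ≤ 1 / M.R5 * ((s t).1 4 - M.x5Star r) ^ 2 := by positivity
    have h7 : 0 ≤ 1 / M.R7 * (e7 t + e8 t) ^ 2 := by positivity
    have h8 : 0 ≤ 1 / M.R7 * ((s t).1 8 - r.x9 - e7 t) ^ 2 := by positivity
    simp only [busDissipation]
    linarith
  · have h1 : 0 ≤ M.C2 * ((s t).1 1 - M.x2Star r) ^ 2 := by positivity
    have h4 : 0 ≤ M.C5 * ((s t).1 4 - M.x5Star r) ^ 2 := by positivity
    have h8 : 0 ≤ M.C9 * (s t).1 8 ^ 2 := by positivity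
    -- Completing the squares in e₇ and e₈ costs x₉*²/(2R₇) and x₉*²/R₇, which add up to -m.
    have h6 : 0 ≤ 1 / M.R7 * (e7 t + r.x9) ^ 2 := by positivity
    have h7 : 0 ≤ 1 / M.R7 * (e8 t - 2 * r.x9) ^ 2 := by positivity
    linarith
  -- Along this filter the dissipation vanishes, so the state with x₈ reset tends to xᵉ. The rate
  -- ignores x₈, is continuous at xᵉ and is zero there, so it is eventually at most 1.
  · set l := atTop ⊓ comap (fun t => M.busDissipation r (s t).1) (𝓝 0)
    have hl : l ≤ atTop := inf_le_left
    obtain ⟨h1, h4, h8⟩ := tendsto_of_busDissipation (M := M) (r := r) (l := l)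
      (x := fun t => (s t).1) (tendsto_comap.mono_left inf_le_right)
    have hw := tendsto_reset_xe (K := K) (l := l) (s := s) hx9 hbal hadm (fun i hi6 hi7 => by
      by_cases hi1 : i = 1
      · subst hi1; exact h1
      by_cases hi4 : i = 4
      · subst hi4; exact h4
      by_cases hi8 : i = 8
      · subst hi8; exact h8
      exact (hlin i hi6 hi7 hi1 hi4 hi8).mono_left hl) (fun i => (ha i).mono_left hl)
      ((tendsto_e7 hs hsadm hVS).mono_left hl)
    have hcont : ContinuousAt (M.busDissipationRate r) (M.xe r, 0) := by
      have hd i : ContinuousAt (fun s => (M.drift r K s).1 i) (M.xe r, 0) :=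
        ((continuous_apply i).comp continuous_fst).continuousAt.comp
          (contDiffAt_drift r K (n := 0) (s := (M.xe r, 0)) hadm).continuousAt
      exact ((ContinuousAt.mul (by fun_prop) (hd 1)).add
        (ContinuousAt.mul (by fun_prop) (hd 4))).add (ContinuousAt.mul (by fun_prop) (hd 8))
    have hlim := hcont.tendsto.comp hw
    have h0 : M.busDissipationRate r (M.xe r, 0) = 0 := by simp [busDissipationRate, xe]
    rw [h0] at hlim
    filter_upwards [hlim.eventually_le_const one_pos] with t ht
    rwa [Function.comp_apply, busDissipationRate_add_unit7] at ht

end Microgrid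

end

/-! ### Convergence of the full state -/

theorem theorem1 (M : Microgrid) (r : References)
    (hx1 : r.x1 ∈ Set.Icc (M.gamma1 * M.VPV) M.VPV) (hx9 : 0 < r.x9) (hx4 : 0 < r.x4)
    (h2 : 0 ≤ M.radicand2 r) (h5 : 0 ≤ M.radicand5 r)
    (hbal : M.CurrentBalance r) (hadm : M.Admissible (M.xe r)) :
    ∃ c : Controller, IsPIBackstepping M r c ∧
      (∀ vS : ℝ, 0 < vS → c.closedLoop M vS (M.xe r, 0) = 0) ∧
      ∀ (VS : ℝ → ℝ) (s : ℝ → AugState), (∀ t, 0 ≤ t → 0 < VS t) → c.IsEvolution M VS s →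
        (∀ t, 0 ≤ t → M.Admissible (s t).1) →
        Filter.Tendsto (fun t => (s t).1) Filter.atTop (nhds (M.xe r)) := by
  refine ⟨piBackstepping M r M.stableGains, ⟨_, M.stableGains_positive, rfl⟩,
    fun vS hvS => Microgrid.closedLoop_xe hx9 h2 h5 hbal hadm hvS, fun VS s hVS hs hsadm => ?_⟩
  obtain ⟨h0, h2', ha0, ha1⟩ := Microgrid.tendsto_pv hs hsadm
  obtain ⟨h3, h5', ha2, ha3⟩ := Microgrid.tendsto_bat hs hsadm
  have ha : ∀ i, Tendsto (fun t => (s t).2 i) atTop (𝓝 0) := by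
    intro i
    fin_cases i
    exacts [ha0, ha1, ha2, ha3]
  have hq := Microgrid.tendsto_busDissipation hx9 hbal hadm hVS hs hsadm
    (fun i _ _ _ _ _ => by fin_cases i <;> first | contradiction | assumption) ha
  obtain ⟨h1, h4, h8⟩ := Microgrid.tendsto_of_busDissipation hq
  have hw := Microgrid.tendsto_reset_xe (K := M.stableGains) hx9 hbal hadm
    (fun i _ _ => by fin_cases i <;> first | contradiction | assumption) ha
    (Microgrid.tendsto_e7 hs hsadm hVS)
  have hz := ((Microgrid.contDiffAt_z8 r M.stableGains (n := 0) (s := (M.xe r, 0))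
    hadm).continuousAt.tendsto).comp hw
  rw [Microgrid.z8_xe hx9 h2 h5 hbal hadm] at hz
  -- x₈ comes last: z₈ takes the same value on the reset state, so z₈ → 0 by continuity, and x₈ =
  -- (x₈ - z₈) + z₈.
  have h7 : Tendsto (fun t => (s t).1 7) atTop (𝓝 0) := by
    have h := (Microgrid.tendsto_e8 hs hsadm hVS).add hz
    rw [add_zero] at h
    exact h.congr fun t => by simp only [Function.comp_apply, Microgrid.z8_add_unit7]; ring
  refine tendsto_pi_nhds.2 fun i => ?_
  by_cases hi : i = 7
  · subst hi
    exact h7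
  · have h := tendsto_pi_nhds.1 ((continuous_fst.tendsto _).comp hw) i
    simpa [Microgrid.unit, Pi.single_apply, hi] using h
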